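/- Let $K$ be a field, let $\Delta$ be a simplicial complex on the vertex set $[n]=\{1,\dots,n\}$ (every $\{i\}$ is a face, and so is $\emptyset$), and let $R=R_\Delta=K[x_Ft : F\in\Delta]\subseteq K[x_1,\dots,x_n,t]$ be its toric ring, where $x_F=\prod_{i\in F}x_i$ and $x_\emptyset=1$; in particular $t=x_\emptyset t\in R$. Suppose that $R$ is a normal domain. Then the ideal $(t)$ of $R$ has finitely many minimal prime ideals $P_1,\dots,P_r$. Each $P_i$ has height one, $R_{P_i}$ is a discrete valuation ring, and there is a unique integer $a_i\ge 0$ with $tR_{P_i}=P_i^{a_i}R_{P_i}$. The divisor class group $\operatorname{Cl}(R)$ (the free abelian group on the height one primes of $R$ modulo the divisors $\sum_P v_P(g)P$ of the nonzero elements $g$ of the fraction field of $R$) is generated by the classes $[P_1],\dots,[P_r]$, and $\sum_{i=1}^r a_i[P_i]=0$ is the only generating relation among these generators: for $b_1,\dots,b_r\in\mathbb{Z}$, one has $\sum_{i=1}^r b_i[P_i]=0$ in $\operatorname{Cl}(R)$ if and only if there is $c\in\mathbb{Z}$ with $b_i=c\,a_i$ for all $i$. -/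

import Mathlib

/-- The polynomial ring `K[x₁, …, xₙ, t]`: the variable indexed by `some i` is `xᵢ`, the variable
indexed by `none` is `t`. -/
abbrev PolyXT (K : Type*) [Field K] (n : ℕ) : Type _ := MvPolynomial (Option (Fin n)) K

/-- The monomial `x_F t`, where `x_F = ∏_{i ∈ F} xᵢ` (so `x_∅ t = t`). -/
noncomputable def faceMonomial (K : Type*) [Field K] {n : ℕ} (F : Finset (Fin n)) : PolyXT K n :=
  (∏ i ∈ F, MvPolynomial.X (some i)) * MvPolynomial.X none

/-- The toric ring `R_Δ = K[x_F t : F ∈ Δ]` of a simplicial complex `Δ` on the vertex set `[n]`.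
Mathlib's `AbstractSimplicialComplex` lists the nonempty faces only (all singletons are faces),
so that the empty face is added here. -/
noncomputable def toricRing (K : Type*) [Field K] {n : ℕ}
    (Δ : AbstractSimplicialComplex (Fin n)) : Subalgebra K (PolyXT K n) :=
  Algebra.adjoin K (faceMonomial K '' insert ∅ Δ.faces)

/-- The element `t` of `R_Δ`, the generator that corresponds to the empty face. -/
noncomputable def toricT (K : Type*) [Field K] {n : ℕ}
    (Δ : AbstractSimplicialComplex (Fin n)) : toricRing K Δ :=
  ⟨faceMonomial K ∅, Algebra.subset_adjoin ⟨∅, Set.mem_insert _ _, rfl⟩⟩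

instance toricRing_isNoetherianRing (K : Type*) [Field K] {n : ℕ}
    (Δ : AbstractSimplicialComplex (Fin n)) : IsNoetherianRing (toricRing K Δ) := by
  have hfin : (faceMonomial K '' insert ∅ Δ.faces).Finite := (Set.toFinite _).image _
  have hfg : (toricRing K Δ).FG := Subalgebra.fg_def.2 ⟨_, hfin, rfl⟩
  have : Algebra.FiniteType K (toricRing K Δ) := (Subalgebra.fg_iff_finiteType _).1 hfg
  exact Algebra.FiniteType.isNoetherianRing K _

/-- The prime ideals of height one of a commutative ring. -/
abbrev HeightOnePrime (R : Type*) [CommRing R] : Type _ :=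
  {p : PrimeSpectrum R // p.asIdeal.height = 1}

namespace HeightOnePrime

variable {R : Type*} [CommRing R] [IsDomain R] [IsNoetherianRing R]

/-- The localization `R_p`. -/
abbrev Loc (p : HeightOnePrime R) : Type _ := Localization.AtPrime p.1.asIdeal

instance krullDimLE_one_loc (p : HeightOnePrime R) : Ring.KrullDimLE 1 p.Loc := by
  rw [Ring.krullDimLE_iff, IsLocalization.AtPrime.ringKrullDim_eq_height p.1.asIdeal p.Loc, p.2]
  rfl

/-- The order `v_p(g) ∈ ℤ` of an element `g` of the fraction field of `R` at a prime `p` of height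
one, i.e. `v_p(x / y) = length (R_p / x R_p) - length (R_p / y R_p)`. If `R_p` is a discrete
valuation ring, this is its valuation. The value at `g = 0` is not used. -/
noncomputable def order (p : HeightOnePrime R) (g : FractionRing R) : ℤ :=
  WithZero.log (Ring.ordFrac p.Loc g)

end HeightOnePrime

/-- The group `Div(R)` of divisors: the free abelian group on the primes of height one. -/
abbrev DivisorGroup (R : Type*) [CommRing R] : Type _ := HeightOnePrime R →₀ ℤ

/-- The group of principal divisors: `D` is principal if `D = div(g) = ∑ v_p(g) p` for
a nonzero element `g` of the fraction field. (As `R` is Noetherian, only finitely many of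
the `v_p(g)` are nonzero, so that every nonzero `g` has such a divisor.) -/
noncomputable def principalDivisors (R : Type*) [CommRing R] [IsDomain R] [IsNoetherianRing R] :
    AddSubgroup (DivisorGroup R) where
  carrier := {D | ∃ g : FractionRing R, g ≠ 0 ∧ ∀ p, D p = p.order g}
  zero_mem' := ⟨1, one_ne_zero, fun p => by simp [HeightOnePrime.order]⟩
  add_mem' := by
    rintro D E ⟨g, hg, hD⟩ ⟨h, hh, hE⟩
    refine ⟨g * h, mul_ne_zero hg hh, fun p => ?_⟩
    rw [Finsupp.add_apply, hD, hE, HeightOnePrime.order, HeightOnePrime.order,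
      HeightOnePrime.order, map_mul, WithZero.log_mul ((map_ne_zero _).2 hg)
      ((map_ne_zero _).2 hh)]
  neg_mem' := by
    rintro D ⟨g, hg, hD⟩
    refine ⟨g⁻¹, inv_ne_zero hg, fun p => ?_⟩
    rw [Finsupp.neg_apply, hD, HeightOnePrime.order, HeightOnePrime.order, map_inv₀,
      WithZero.log_inv]

/-- The divisor class group `Cl(R)`: divisors modulo principal divisors. -/
abbrev DivisorClassGroup (R : Type*) [CommRing R] [IsDomain R] [IsNoetherianRing R] : Type _ :=
  DivisorGroup R ⧸ principalDivisors R

/-- The class `[p]` in `Cl(R)` of a prime `p` of height one. -/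
noncomputable def HeightOnePrime.divisorClass {R : Type*} [CommRing R] [IsDomain R]
    [IsNoetherianRing R] (p : HeightOnePrime R) : DivisorClassGroup R :=
  QuotientAddGroup.mk (Finsupp.single p 1)

/-! This is Nagata's argument for inverting a prime-like element. Since `∅` and every `{i}` are
faces, `xᵢ = (xᵢt)/t`, so `R` and `S = K[x₁, …, xₙ, t]` agree once `t` is inverted. `S` is a UFD in
which `t` is prime and the units are constants. Generation: a height one prime `Q` of `R` with `t ∉
Q` is the contraction of a prime element `p ≠ t` of `S`. A multiple `t ^ N * p` lying in `R` has
order one at `Q` and order zero at every other prime avoiding `t`, so `[Q]` is a combination of the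
`[Pᵢ]` (`exists_order_eq`). Relations: if `div(f)` is supported on the `Pᵢ`, then `f` is a unit of
`R` times `t ^ c` (`exists_eq_zpow_mul`), so `div(f) = c • div(t)`, and `div(t)` has coefficients
`aᵢ`. Normality enters only to make each `R_P` a discrete valuation ring. -/

/-! ### Orders at height one primes -/

namespace HeightOnePrime

variable {R : Type*} [CommRing R]

theorem map_asIdeal_eq_maximalIdeal (p : HeightOnePrime R) :
    p.1.asIdeal.map (algebraMap R p.Loc) = IsLocalRing.maximalIdeal p.Loc :=
  Localization.AtPrime.map_eq_maximalIdeal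

variable [IsDomain R]

theorem algebraMap_loc_ne_zero (p : HeightOnePrime R) {x : R} (hx : x ≠ 0) :
    algebraMap R p.Loc x ≠ 0 := by
  rwa [Ne, FaithfulSMul.algebraMap_eq_zero_iff]

theorem asIdeal_ne_bot (p : HeightOnePrime R) : p.1.asIdeal ≠ ⊥ := fun h => by
  have := p.2
  rw [h, Ideal.height_eq_zero_iff_eq_bot.2 rfl] at this
  exact zero_ne_one this

variable [IsNoetherianRing R]

theorem eq_of_le {P Q : Ideal R} [P.IsPrime] [Q.IsPrime] (hP : P ≠ ⊥) (hQ : Q.height = 1)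
    (h : P ≤ Q) : P = Q := by
  by_contra hne
  have hlt := Ideal.height_strict_mono_of_isPrime (lt_of_le_of_ne h hne)
  rw [hQ, Order.lt_one_iff, Ideal.height_eq_zero_iff_eq_bot] at hlt
  exact hP hlt

/-- Krull's principal ideal theorem bounds the height by one, and in a domain only the zero ideal
has height zero. -/
theorem height_eq_one_of_mem_minimalPrimes_span_singleton {x : R} (hx : x ≠ 0) {P : Ideal R}
    (hP : P ∈ (Ideal.span {x}).minimalPrimes) : P.height = 1 := by
  refine le_antisymm (Ideal.height_le_one_of_isPrincipal_of_mem_minimalPrimes _ P hP) ?_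
  rw [Order.one_le_iff_ne_zero, Ne, Ideal.height_eq_zero_iff_eq_bot]
  rintro rfl
  exact hx (by simpa using hP.1.2)

theorem mem_minimalPrimes_span_singleton (Q : HeightOnePrime R) {x : R} (hx : x ≠ 0)
    (h : x ∈ Q.1.asIdeal) : Q.1.asIdeal ∈ (Ideal.span {x}).minimalPrimes := by
  refine ⟨⟨Q.1.isPrime, by simpa using h⟩, fun J ⟨hJ, hxJ⟩ hle => ?_⟩
  refine (eq_of_le ?_ Q.2 hle).ge
  rintro rfl
  exact hx (by simpa using hxJ)

theorem order_mul (p : HeightOnePrime R) {g h : FractionRing R} (hg : g ≠ 0) (hh : h ≠ 0) :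
    p.order (g * h) = p.order g + p.order h := by
  rw [order, map_mul, WithZero.log_mul ((map_ne_zero _).2 hg) ((map_ne_zero _).2 hh)]
  rfl

theorem order_div (p : HeightOnePrime R) {g h : FractionRing R} (hg : g ≠ 0) (hh : h ≠ 0) :
    p.order (g / h) = p.order g - p.order h := by
  rw [order, map_div₀, WithZero.log_div ((map_ne_zero _).2 hg) ((map_ne_zero _).2 hh)]
  rfl

theorem order_zpow (p : HeightOnePrime R) (g : FractionRing R) (c : ℤ) :
    p.order (g ^ c) = c * p.order g := by
  rw [order, map_zpow₀, WithZero.log_zpow, smul_eq_mul]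
  rfl

variable [IsIntegrallyClosed R]

instance isDiscreteValuationRing_loc (p : HeightOnePrime R) : IsDiscreteValuationRing p.Loc := by
  have hmax : IsLocalRing.maximalIdeal p.Loc ≠ ⊥ := by
    rw [← map_asIdeal_eq_maximalIdeal, Ne,
      Ideal.map_eq_bot_iff_of_injective (FaithfulSMul.algebraMap_injective R p.Loc)]
    exact p.asIdeal_ne_bot
  have hheight : (IsLocalRing.maximalIdeal p.Loc).height = 1 := by
    have h := IsLocalization.AtPrime.ringKrullDim_eq_height p.1.asIdeal p.Loc
    rw [← IsLocalRing.maximalIdeal_height_eq_ringKrullDim, p.2] at h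
    exact_mod_cast h
  have hic : IsIntegrallyClosed p.Loc := isIntegrallyClosed_of_isLocalization _
    p.1.asIdeal.primeCompl p.1.asIdeal.primeCompl_le_nonZeroDivisors
  have htfae := (tfae_of_isNoetherianRing_of_isLocalRing_of_isDomain p.Loc).out 3 0
  have hpir := htfae.1
    ⟨hic, fun P hP _ => eq_of_le hP hheight (IsLocalRing.le_maximalIdeal Ideal.IsPrime.ne_top')⟩
  exact { hpir with not_a_field' := hmax }

theorem order_algebraMap (p : HeightOnePrime R) {x : R} (hx : x ≠ 0) {a : ℕ}
    (h : Ideal.span {algebraMap R p.Loc x} = (p.1.asIdeal.map (algebraMap R p.Loc)) ^ a) :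
    p.order (algebraMap R (FractionRing R) x) = a := by
  obtain ⟨ϖ, hϖ⟩ := IsDiscreteValuationRing.exists_irreducible p.Loc
  have hϖ0 : ϖ ∈ nonZeroDivisors p.Loc := mem_nonZeroDivisors_of_ne_zero hϖ.ne_zero
  have hord : Ring.ord p.Loc (algebraMap R p.Loc x) = a := by
    rw [map_asIdeal_eq_maximalIdeal, hϖ.maximalIdeal_eq, Ideal.span_singleton_pow] at h
    rw [Ring.ord, h]
    -- `Ring.ord` depends only on the ideal generated, so the element may be replaced by `ϖ ^ a`.
    change Ring.ord p.Loc (ϖ ^ a) = a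
    rw [Ring.ord_pow hϖ0, Ring.ord_of_irreducible hϖ, nsmul_one]
  have hx' := p.algebraMap_loc_ne_zero hx
  rw [order, IsScalarTower.algebraMap_apply R p.Loc (FractionRing R), Ring.ordFrac_eq_ord _ hx',
    Ring.ordMonoidWithZeroHom_eq_coe _ (mem_nonZeroDivisors_of_ne_zero hx') hord]
  rfl

theorem existsUnique_span_eq_pow (p : HeightOnePrime R) {x : R} (hx : x ≠ 0) :
    ∃! a : ℕ, Ideal.span {algebraMap R p.Loc x} = (p.1.asIdeal.map (algebraMap R p.Loc)) ^ a := by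
  have htfae := (tfae_of_isNoetherianRing_of_isLocalRing_of_isDomain p.Loc).out 0 6
  obtain ⟨a, ha⟩ := htfae.1 inferInstance (Ideal.span {algebraMap R p.Loc x})
    (by simpa using p.algebraMap_loc_ne_zero hx)
  rw [← map_asIdeal_eq_maximalIdeal] at ha
  refine ⟨a, ha, fun b hb => ?_⟩
  exact_mod_cast (p.order_algebraMap hx hb).symm.trans (p.order_algebraMap hx ha)

theorem order_algebraMap_of_notMem (p : HeightOnePrime R) {x : R} (h : x ∉ p.1.asIdeal) :
    p.order (algebraMap R (FractionRing R) x) = 0 := by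
  have hx : x ≠ 0 := fun h0 => h (h0 ▸ zero_mem _)
  refine p.order_algebraMap (a := 0) hx ?_
  rw [pow_zero, Ideal.one_eq_top, Ideal.span_singleton_eq_top]
  exact (IsLocalization.AtPrime.isUnit_to_map_iff p.Loc p.1.asIdeal x).2 h

theorem order_algebraMap_ne_zero (p : HeightOnePrime R) {x : R} (hx : x ≠ 0)
    (h : x ∈ p.1.asIdeal) : p.order (algebraMap R (FractionRing R) x) ≠ 0 := by
  obtain ⟨a, ha, -⟩ := p.existsUnique_span_eq_pow hx
  rw [p.order_algebraMap hx ha, Nat.cast_ne_zero]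
  rintro rfl
  rw [pow_zero, Ideal.one_eq_top, Ideal.span_singleton_eq_top,
    IsLocalization.AtPrime.isUnit_to_map_iff p.Loc p.1.asIdeal x] at ha
  exact ha h

/-- `x` is a uniformizer of `R_p` if it divides every element of `p` up to denominators
outside `p`. -/
theorem order_algebraMap_eq_one (p : HeightOnePrime R) {x : R} (hx : x ≠ 0) (h : x ∈ p.1.asIdeal)
    (hdvd : ∀ y ∈ p.1.asIdeal, ∃ s ∉ p.1.asIdeal, x ∣ s * y) :
    p.order (algebraMap R (FractionRing R) x) = 1 := by
  refine p.order_algebraMap (a := 1) hx ?_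
  rw [pow_one]
  refine le_antisymm ?_ (Ideal.map_le_iff_le_comap.2 fun y hy => ?_)
  · rw [Ideal.span_singleton_le_iff_mem]
    exact Ideal.mem_map_of_mem _ h
  · obtain ⟨s, hs, hsy⟩ := hdvd y hy
    rw [Ideal.mem_comap, Ideal.mem_span_singleton]
    have := map_dvd (algebraMap R p.Loc) hsy
    rwa [map_mul, IsUnit.dvd_mul_left
      ((IsLocalization.AtPrime.isUnit_to_map_iff p.Loc p.1.asIdeal s).2 hs)] at this

end HeightOnePrime

/-! ### Comparing `R` with a factorial ring that agrees with it away from `t` -/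

/-- The element `t` of `R` is prime in `S`, every element of `S` comes from `R` after multiplication
by a power of `t` (so that `R` and `S` agree once `t` is inverted), and every unit of `S` comes from
a unit of `R`. -/
structure IsPrimeDenominator {R : Type*} (S : Type*) [CommRing R] [CommRing S] [Algebra R S]
    (t : R) : Prop where
  prime : Prime (algebraMap R S t)
  exists_pow_mul (s : S) : ∃ (N : ℕ) (r : R), algebraMap R S r = algebraMap R S t ^ N * s
  exists_unit (u : S) : IsUnit u → ∃ w : R, IsUnit w ∧ algebraMap R S w = u

namespace IsPrimeDenominator

variable {R S : Type*} [CommRing R] [CommRing S] [Algebra R S] {t : R}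

theorem ne_zero (h : IsPrimeDenominator S t) : t ≠ 0 := by
  rintro rfl
  exact h.prime.ne_zero (map_zero _)

theorem mem_comap_span {p : S} {r : R} :
    r ∈ (Ideal.span {p}).comap (algebraMap R S) ↔ p ∣ algebraMap R S r := by
  rw [Ideal.mem_comap, Ideal.mem_span_singleton]

theorem comap_span_isPrime {p : S} (hp : Prime p) :
    ((Ideal.span {p}).comap (algebraMap R S)).IsPrime := by
  have := (Ideal.span_singleton_prime hp.ne_zero).2 hp
  exact Ideal.comap_isPrime _ _

variable [FaithfulSMul R S]

/-- Up to a power of `t`, an element of `R` divisible by `p` in `S` is divisible in `R` by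
any multiple `g = t ^ N * p`. -/
theorem exists_dvd_pow_mul (h : IsPrimeDenominator S t) {p : S} {N : ℕ} {g r : R}
    (hg : algebraMap R S g = algebraMap R S t ^ N * p) (hr : p ∣ algebraMap R S r) :
    ∃ M : ℕ, g ∣ t ^ M * r := by
  obtain ⟨s, hs⟩ := hr
  obtain ⟨M, s', hs'⟩ := h.exists_pow_mul s
  refine ⟨N + M, s', FaithfulSMul.algebraMap_injective R S ?_⟩
  rw [map_mul, map_mul, map_pow, hs, hg, hs']
  ring

theorem comap_span_le (h : IsPrimeDenominator S t) {p : S} {N : ℕ} {g : R}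
    (hg : algebraMap R S g = algebraMap R S t ^ N * p) {Q : Ideal R} [hQ : Q.IsPrime]
    (hgQ : g ∈ Q) (ht : t ∉ Q) : (Ideal.span {p}).comap (algebraMap R S) ≤ Q := by
  intro r hr
  obtain ⟨M, hM⟩ := h.exists_dvd_pow_mul hg (mem_comap_span.1 hr)
  exact (hQ.mem_or_mem (Q.mem_of_dvd hM hgQ)).resolve_left fun h' => ht (hQ.mem_of_pow_mem _ h')

variable [IsDomain S]

omit [FaithfulSMul R S] in
theorem not_dvd (h : IsPrimeDenominator S t) {p : S} (hp : Prime p)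
    (hpt : ¬ Associated p (algebraMap R S t)) : ¬ p ∣ algebraMap R S t :=
  fun hd => hpt (hp.associated_of_dvd h.prime hd)

variable [IsDomain R] [IsNoetherianRing R]

/-- The contraction is minimal over `g = t ^ N * p`: a prime below it that contains `g` cannot
contain `t`, hence contains everything divisible by `p`. -/
theorem height_comap_span (h : IsPrimeDenominator S t) {p : S} (hp : Prime p)
    (hpt : ¬ Associated p (algebraMap R S t)) :
    ((Ideal.span {p}).comap (algebraMap R S)).height = 1 := by
  obtain ⟨N, g, hg⟩ := h.exists_pow_mul p
  have hg0 : g ≠ 0 := by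
    rintro rfl
    rw [map_zero] at hg
    exact mul_ne_zero (pow_ne_zero _ h.prime.ne_zero) hp.ne_zero hg.symm
  refine HeightOnePrime.height_eq_one_of_mem_minimalPrimes_span_singleton hg0
    ⟨⟨comap_span_isPrime hp, ?_⟩, fun J ⟨hJ, hgJ⟩ hle => ?_⟩
  · rw [Ideal.span_singleton_le_iff_mem, mem_comap_span, hg]
    exact dvd_mul_left _ _
  · exact h.comap_span_le hg (by simpa using hgJ)
      fun ht => h.not_dvd hp hpt (mem_comap_span.1 (hle ht))

/-- The prime of `R` of height one that a prime element of `S` other than `t` defines. -/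
def contraction (h : IsPrimeDenominator S t) {p : S} (hp : Prime p)
    (hpt : ¬ Associated p (algebraMap R S t)) : HeightOnePrime R :=
  ⟨⟨_, comap_span_isPrime hp⟩, h.height_comap_span hp hpt⟩

theorem mem_contraction (h : IsPrimeDenominator S t) {p : S} (hp : Prime p)
    (hpt : ¬ Associated p (algebraMap R S t)) {r : R} :
    r ∈ (h.contraction hp hpt).1.asIdeal ↔ p ∣ algebraMap R S r :=
  mem_comap_span

theorem notMem_contraction (h : IsPrimeDenominator S t) {p : S} (hp : Prime p)
    (hpt : ¬ Associated p (algebraMap R S t)) : t ∉ (h.contraction hp hpt).1.asIdeal :=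
  fun ht => h.not_dvd hp hpt ((h.mem_contraction hp hpt).1 ht)

theorem eq_contraction (h : IsPrimeDenominator S t) {p : S} (hp : Prime p)
    (hpt : ¬ Associated p (algebraMap R S t)) {N : ℕ} {g : R}
    (hg : algebraMap R S g = algebraMap R S t ^ N * p) {Q : HeightOnePrime R}
    (hgQ : g ∈ Q.1.asIdeal) (ht : t ∉ Q.1.asIdeal) : Q = h.contraction hp hpt := by
  refine Subtype.ext (PrimeSpectrum.ext (HeightOnePrime.eq_of_le
    (h.contraction hp hpt).asIdeal_ne_bot Q.2 (h.comap_span_le hg hgQ ht)).symm)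

variable [IsIntegrallyClosed R]

theorem order_contraction (h : IsPrimeDenominator S t) {p : S} (hp : Prime p)
    (hpt : ¬ Associated p (algebraMap R S t)) {N : ℕ} {g : R}
    (hg : algebraMap R S g = algebraMap R S t ^ N * p) :
    (h.contraction hp hpt).order (algebraMap R (FractionRing R) g) = 1 := by
  refine HeightOnePrime.order_algebraMap_eq_one _ ?_ ?_ fun y hy => ?_
  · rintro rfl
    rw [map_zero] at hg
    exact mul_ne_zero (pow_ne_zero _ h.prime.ne_zero) hp.ne_zero hg.symm
  · rw [mem_contraction, hg]
    exact dvd_mul_left _ _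
  · obtain ⟨M, hM⟩ := h.exists_dvd_pow_mul hg ((h.mem_contraction hp hpt).1 hy)
    exact ⟨t ^ M, fun hm => h.notMem_contraction hp hpt
      ((h.contraction hp hpt).1.isPrime.mem_of_pow_mem _ hm), hM⟩

variable [UniqueFactorizationMonoid S]

-- Induction on the prime factorization of `s`. Clearing denominators by powers of `t`, which lie
-- outside `Q`, lets primality of `Q` select one factor.
omit [IsDomain R] [IsNoetherianRing R] [IsIntegrallyClosed R] [IsDomain S] in
theorem exists_prime_mem (h : IsPrimeDenominator S t) {Q : Ideal R} [hQ : Q.IsPrime]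
    (ht : t ∉ Q) (s : S) (hs : s ≠ 0)
    (hsQ : ∃ (N : ℕ) (r : R), r ∈ Q ∧ algebraMap R S r = algebraMap R S t ^ N * s) :
    ∃ p : S, Prime p ∧
      ∃ (N : ℕ) (r : R), r ∈ Q ∧ algebraMap R S r = algebraMap R S t ^ N * p := by
  induction s using UniqueFactorizationMonoid.induction_on_prime with
  | h₁ => exact absurd rfl hs
  | h₂ u hu =>
    obtain ⟨N, r, hr, hru⟩ := hsQ
    obtain ⟨w, hw, rfl⟩ := h.exists_unit u hu
    have : r = t ^ N * w := FaithfulSMul.algebraMap_injective R S (by simpa using hru)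
    rw [this] at hr
    rcases hQ.mem_or_mem hr with h1 | h1
    · exact absurd (hQ.mem_of_pow_mem _ h1) ht
    · exact absurd (Q.eq_top_of_isUnit_mem h1 hw) hQ.ne_top
  | h₃ a p ha hp ih =>
    obtain ⟨N, r, hr, hrpa⟩ := hsQ
    obtain ⟨N₁, r₁, h₁⟩ := h.exists_pow_mul p
    obtain ⟨N₂, r₂, h₂⟩ := h.exists_pow_mul a
    have : t ^ N * (r₁ * r₂) = t ^ (N₁ + N₂) * r := FaithfulSMul.algebraMap_injective R S (by
      simp only [map_mul, map_pow, h₁, h₂, hrpa]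
      ring)
    have hmem : t ^ N * (r₁ * r₂) ∈ Q := this ▸ Q.mul_mem_left _ hr
    rcases hQ.mem_or_mem ((hQ.mem_or_mem hmem).resolve_left
      fun h' => ht (hQ.mem_of_pow_mem _ h')) with h' | h'
    · exact ⟨p, hp, N₁, r₁, h', h₁⟩
    · exact ih ha ⟨N₂, r₂, h', h₂⟩

/-- A prime of height one that does not contain `t` is cut out by an element of `R` up to the
primes that contain `t`. -/
theorem exists_order_eq (h : IsPrimeDenominator S t) (Q : HeightOnePrime R)
    (ht : t ∉ Q.1.asIdeal) :
    ∃ g : R, g ≠ 0 ∧ Q.order (algebraMap R (FractionRing R) g) = 1 ∧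
      ∀ Q' : HeightOnePrime R, Q' ≠ Q → t ∉ Q'.1.asIdeal →
        Q'.order (algebraMap R (FractionRing R) g) = 0 := by
  obtain ⟨x, hx, hx0⟩ := Submodule.exists_mem_ne_zero_of_ne_bot Q.asIdeal_ne_bot
  obtain ⟨p, hp, N, g, hgQ, hg⟩ := h.exists_prime_mem ht (algebraMap R S x)
    (by rwa [Ne, FaithfulSMul.algebraMap_eq_zero_iff]) ⟨0, x, hx, by simp⟩
  -- Otherwise `g` is a unit of `R` times a power of `t`, and cannot lie in `Q`.
  have hpt : ¬ Associated p (algebraMap R S t) := by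
    intro hass
    obtain ⟨w, hw, hwu⟩ := h.exists_unit _ hass.symm.choose.isUnit
    have : g = t ^ N * (t * w) := FaithfulSMul.algebraMap_injective R S (by
      rw [hg, map_mul, map_mul, map_pow, hwu, hass.symm.choose_spec])
    rw [this, ← mul_assoc, ← pow_succ] at hgQ
    rcases Q.1.isPrime.mem_or_mem hgQ with h1 | h1
    · exact ht (Q.1.isPrime.mem_of_pow_mem _ h1)
    · exact Q.1.isPrime.ne_top (Ideal.eq_top_of_isUnit_mem _ h1 hw)
  obtain rfl := h.eq_contraction hp hpt hg hgQ ht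
  have h1 := h.order_contraction hp hpt hg
  refine ⟨g, ?_, h1, fun Q' hne ht' => HeightOnePrime.order_algebraMap_of_notMem _
    fun hgQ' => hne (h.eq_contraction hp hpt hg hgQ' ht')⟩
  -- The order of `0` is `0` by convention, which contradicts order one.
  rintro rfl
  simp [HeightOnePrime.order] at h1

/-- A prime factor `p` of `u` other than `t` does not divide `v`, so at the contraction of `p` the
order of `x` is nonzero while that of `y` is zero. -/
theorem exists_associated_pow (h : IsPrimeDenominator S t) {u v : S} {M : ℕ} {x y : R}
    (hx : algebraMap R S x = algebraMap R S t ^ M * u)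
    (hy : algebraMap R S y = algebraMap R S t ^ M * v) (hu : u ≠ 0)
    (huv : IsRelPrime u v)
    (hord : ∀ Q : HeightOnePrime R, t ∉ Q.1.asIdeal →
      Q.order (algebraMap R (FractionRing R) x) = Q.order (algebraMap R (FractionRing R) y)) :
    ∃ i : ℕ, Associated u (algebraMap R S t ^ i) := by
  obtain ⟨i, u', hdvd, rfl⟩ := WfDvdMonoid.max_power_factor hu h.prime.irreducible
  have hu' : u' ≠ 0 := right_ne_zero_of_mul hu
  refine ⟨i, ?_⟩
  suffices IsUnit u' from (associated_mul_unit_left _ _ this)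
  by_contra hunit
  obtain ⟨p, hp, hpu⟩ := WfDvdMonoid.exists_irreducible_factor hunit hu'
  rw [UniqueFactorizationMonoid.irreducible_iff_prime] at hp
  have hpt : ¬ Associated p (algebraMap R S t) := fun hass => hdvd (hass.symm.dvd.trans hpu)
  have hx0 : x ≠ 0 := by
    rintro rfl
    rw [map_zero] at hx
    exact mul_ne_zero (pow_ne_zero _ h.prime.ne_zero) hu hx.symm
  have hxQ : x ∈ (h.contraction hp hpt).1.asIdeal := by
    rw [mem_contraction, hx]
    exact (hpu.mul_left _).mul_left _
  have hyQ : y ∉ (h.contraction hp hpt).1.asIdeal := by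
    rw [mem_contraction, hy]
    intro hd
    rcases hp.dvd_or_dvd hd with hd | hd
    · exact h.not_dvd hp hpt (hp.dvd_of_dvd_pow hd)
    · exact hp.not_isUnit (huv (hpu.mul_left _) hd)
  refine HeightOnePrime.order_algebraMap_ne_zero _ hx0 hxQ ?_
  rw [hord _ (h.notMem_contraction hp hpt), HeightOnePrime.order_algebraMap_of_notMem _ hyQ]

/-- An element of the fraction field whose divisor is supported at the primes that contain `t` is
a power of `t` up to a unit. -/
theorem exists_eq_zpow_mul (h : IsPrimeDenominator S t) {f : FractionRing R} (hf : f ≠ 0)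
    (hord : ∀ Q : HeightOnePrime R, t ∉ Q.1.asIdeal → Q.order f = 0) :
    ∃ (c : ℤ) (w : R), IsUnit w ∧
      f = algebraMap R (FractionRing R) t ^ c * algebraMap R (FractionRing R) w := by
  obtain ⟨a, b, hb, rfl⟩ := IsFractionRing.div_surjective (A := R) f
  have hinj := FaithfulSMul.algebraMap_injective R S
  have hinjF := IsFractionRing.injective R (FractionRing R)
  have hb0 : b ≠ 0 := nonZeroDivisors.ne_zero hb
  have ha0 : a ≠ 0 := by
    rintro rfl
    simp at hf
  obtain ⟨u, v, d, huv, hda, hdb⟩ := UniqueFactorizationMonoid.exists_reduced_factors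
    (algebraMap R S a) (by rwa [Ne, FaithfulSMul.algebraMap_eq_zero_iff]) (algebraMap R S b)
  have hu : u ≠ 0 := by
    rintro rfl
    rw [mul_zero, eq_comm, FaithfulSMul.algebraMap_eq_zero_iff] at hda
    exact ha0 hda
  have hv : v ≠ 0 := by
    rintro rfl
    rw [mul_zero, eq_comm, FaithfulSMul.algebraMap_eq_zero_iff] at hdb
    exact hb0 hdb
  have hd : d ≠ 0 := by
    rintro rfl
    rw [zero_mul, eq_comm, FaithfulSMul.algebraMap_eq_zero_iff] at hdb
    exact hb0 hdb
  obtain ⟨M₁, x', hx'⟩ := h.exists_pow_mul u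
  obtain ⟨M₂, y', hy'⟩ := h.exists_pow_mul v
  -- Equalizing the powers of `t` makes `x / y` equal to the reduced fraction `u / v`.
  have hx : algebraMap R S (t ^ M₂ * x') = algebraMap R S t ^ (M₁ + M₂) * u := by
    rw [map_mul, map_pow, hx']
    ring
  have hy : algebraMap R S (t ^ M₁ * y') = algebraMap R S t ^ (M₁ + M₂) * v := by
    rw [map_mul, map_pow, hy']
    ring
  generalize t ^ M₂ * x' = x at hx
  generalize t ^ M₁ * y' = y at hy
  have hx0 : x ≠ 0 := by
    rintro rfl
    rw [map_zero] at hx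
    exact mul_ne_zero (pow_ne_zero _ h.prime.ne_zero) hu hx.symm
  have hy0 : y ≠ 0 := by
    rintro rfl
    rw [map_zero] at hy
    exact mul_ne_zero (pow_ne_zero _ h.prime.ne_zero) hv hy.symm
  have hF {r : R} (hr : r ≠ 0) : algebraMap R (FractionRing R) r ≠ 0 := by
    rwa [Ne, FaithfulSMul.algebraMap_eq_zero_iff]
  have hab : algebraMap R (FractionRing R) a / algebraMap R (FractionRing R) b =
      algebraMap R (FractionRing R) x / algebraMap R (FractionRing R) y := by
    rw [div_eq_div_iff (hF hb0) (hF hy0), ← map_mul, ← map_mul]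
    congr 1
    apply hinj
    rw [map_mul, map_mul, hx, hy, ← hda, ← hdb]
    ring
  rw [hab] at hord ⊢
  replace hord : ∀ Q : HeightOnePrime R, t ∉ Q.1.asIdeal →
      Q.order (algebraMap R (FractionRing R) x) = Q.order (algebraMap R (FractionRing R) y) := by
    intro Q ht
    have := hord Q ht
    rwa [Q.order_div (hF hx0) (hF hy0), sub_eq_zero] at this
  obtain ⟨i, α, hi⟩ := h.exists_associated_pow hx hy hu huv hord
  obtain ⟨j, β, hj⟩ := h.exists_associated_pow hy hx hv huv.symm fun Q ht => (hord Q ht).symm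
  -- From `u * α = t ^ i` and `v * β = t ^ j` one gets `u / v = t ^ (i - j) * (β * α⁻¹)`.
  obtain ⟨w, hw, hwu⟩ := h.exists_unit ↑(β * α⁻¹) (Units.isUnit _)
  refine ⟨(i : ℤ) - j, w, hw, ?_⟩
  have ht0 := hF h.ne_zero
  rw [zpow_sub₀ ht0, zpow_natCast, zpow_natCast, div_mul_eq_mul_div,
    div_eq_div_iff (hF hy0) (pow_ne_zero _ ht0)]
  simp only [← map_mul, ← map_pow]
  congr 1
  apply hinj
  simp only [map_mul, map_pow]
  rw [hx, hy, hwu, ← hi, ← hj, Units.val_mul]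
  linear_combination (algebraMap R S t ^ (M₁ + M₂) * u * v * (β : S)) * (-α.mul_inv)

end IsPrimeDenominator

/-! ### Generators and relations of the class group -/

namespace IsPrimeDenominator

variable {R S : Type*} [CommRing R] [IsDomain R] [IsNoetherianRing R] [CommRing S] [Algebra R S]
  {t : R} {r : ℕ} {P : Fin r → HeightOnePrime R}

omit [IsDomain R] [IsNoetherianRing R] in
theorem mem_of_range_eq
    (hrange : Set.range (fun i => (P i).1.asIdeal) = (Ideal.span {t}).minimalPrimes) (i : Fin r) :
    t ∈ (P i).1.asIdeal := by
  have : (P i).1.asIdeal ∈ (Ideal.span {t}).minimalPrimes := hrange ▸ Set.mem_range_self i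
  simpa using this.1.2

theorem exists_eq_of_mem (h : IsPrimeDenominator S t)
    (hrange : Set.range (fun i => (P i).1.asIdeal) = (Ideal.span {t}).minimalPrimes)
    {Q : HeightOnePrime R} (hQ : t ∈ Q.1.asIdeal) : ∃ i, P i = Q := by
  have hmem := Q.mem_minimalPrimes_span_singleton h.ne_zero hQ
  rw [← hrange] at hmem
  obtain ⟨i, hi⟩ := hmem
  exact ⟨i, Subtype.ext (PrimeSpectrum.ext hi)⟩

omit [IsDomain R] [IsNoetherianRing R] in
theorem sum_single_apply (hP : Function.Injective P) (b : Fin r → ℤ) (j : Fin r) :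
    (∑ i, b i • Finsupp.single (P i) (1 : ℤ)) (P j) = b j := by
  classical
  simp [Finsupp.finsetSum_apply, Finsupp.single_apply, hP.eq_iff]

omit [IsDomain R] [IsNoetherianRing R] in
theorem sum_single_apply_of_notMem
    (hrange : Set.range (fun i => (P i).1.asIdeal) = (Ideal.span {t}).minimalPrimes)
    (b : Fin r → ℤ) {Q : HeightOnePrime R} (hQ : t ∉ Q.1.asIdeal) :
    (∑ i, b i • Finsupp.single (P i) (1 : ℤ)) Q = 0 := by
  have (i : Fin r) : P i ≠ Q := by
    rintro rfl
    exact hQ (mem_of_range_eq hrange i)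
  simp [Finsupp.finsetSum_apply, this]

theorem mk_sum_single (b : Fin r → ℤ) :
    (QuotientAddGroup.mk (∑ i, b i • Finsupp.single (P i) (1 : ℤ)) : DivisorClassGroup R) =
      ∑ i, b i • (P i).divisorClass := by
  change QuotientAddGroup.mk' (principalDivisors R) _ = _
  simp only [map_sum, map_zsmul]
  rfl

variable [IsDomain S] [FaithfulSMul R S] [IsIntegrallyClosed R] [UniqueFactorizationMonoid S]

theorem closure_divisorClass_eq_top (h : IsPrimeDenominator S t) (hP : Function.Injective P)
    (hrange : Set.range (fun i => (P i).1.asIdeal) = (Ideal.span {t}).minimalPrimes) :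
    AddSubgroup.closure (Set.range fun i => (P i).divisorClass) = ⊤ := by
  have hP_mem (i : Fin r) : (P i).divisorClass ∈
      AddSubgroup.closure (Set.range fun i => (P i).divisorClass) :=
    AddSubgroup.subset_closure (Set.mem_range_self i)
  have hclass (Q : HeightOnePrime R) : Q.divisorClass ∈
      AddSubgroup.closure (Set.range fun i => (P i).divisorClass) := by
    by_cases hQ : t ∈ Q.1.asIdeal
    · obtain ⟨i, rfl⟩ := h.exists_eq_of_mem hrange hQ
      exact hP_mem i
    obtain ⟨g, hg, hgQ, hgQ'⟩ := h.exists_order_eq Q hQ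
    -- This is the full divisor of `g`: away from `t` only `Q` contributes.
    have hprin : Finsupp.single Q 1 + ∑ i, (P i).order (algebraMap R (FractionRing R) g) •
        Finsupp.single (P i) (1 : ℤ) ∈ principalDivisors R := by
      refine ⟨algebraMap R (FractionRing R) g,
        by rwa [Ne, FaithfulSMul.algebraMap_eq_zero_iff], fun Q' => ?_⟩
      rw [Finsupp.add_apply]
      by_cases hQ' : t ∈ Q'.1.asIdeal
      · obtain ⟨i, rfl⟩ := h.exists_eq_of_mem hrange hQ'
        have hne : P i ≠ Q := fun he => hQ (he ▸ hQ')
        rw [sum_single_apply hP (fun i => (P i).order _), Finsupp.single_eq_of_ne hne, zero_add]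
      · rw [sum_single_apply_of_notMem hrange _ hQ', add_zero]
        by_cases hne : Q' = Q
        · rw [hne, hgQ, Finsupp.single_eq_same]
        · rw [hgQ' Q' hne hQ', Finsupp.single_eq_of_ne hne]
    rw [← QuotientAddGroup.eq_zero_iff, QuotientAddGroup.mk_add, mk_sum_single] at hprin
    rw [show Q.divisorClass = _ from eq_neg_of_add_eq_zero_left hprin]
    exact neg_mem (sum_mem fun i _ => zsmul_mem (hP_mem i) _)
  refine eq_top_iff.2 fun x _ => ?_
  obtain ⟨D, rfl⟩ := QuotientAddGroup.mk_surjective x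
  induction D using Finsupp.induction_linear with
  | zero => exact zero_mem _
  | add D E hD hE => exact add_mem (hD trivial) (hE trivial)
  | single Q m =>
    rw [← mul_one m, ← smul_eq_mul, ← Finsupp.smul_single, QuotientAddGroup.mk_zsmul]
    exact zsmul_mem (hclass Q) m

theorem sum_smul_divisorClass_eq_zero_iff (h : IsPrimeDenominator S t)
    (hP : Function.Injective P)
    (hrange : Set.range (fun i => (P i).1.asIdeal) = (Ideal.span {t}).minimalPrimes)
    {a : Fin r → ℕ} (ha : ∀ i, Ideal.span {algebraMap R (P i).Loc t} =
      ((P i).1.asIdeal.map (algebraMap R (P i).Loc)) ^ a i) (b : Fin r → ℤ) :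
    ∑ i, b i • (P i).divisorClass = 0 ↔ ∃ c : ℤ, ∀ i, b i = c * a i := by
  have ht0 : algebraMap R (FractionRing R) t ≠ 0 := by
    rw [Ne, FaithfulSMul.algebraMap_eq_zero_iff]
    exact h.ne_zero
  rw [← mk_sum_single, QuotientAddGroup.eq_zero_iff]
  constructor
  · rintro ⟨f, hf, hdiv⟩
    obtain ⟨c, w, hw, rfl⟩ := h.exists_eq_zpow_mul hf fun Q hQ => by
      rw [← hdiv, sum_single_apply_of_notMem hrange _ hQ]
    refine ⟨c, fun i => ?_⟩
    rw [← sum_single_apply hP b i, hdiv, HeightOnePrime.order_mul _ (left_ne_zero_of_mul hf)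
      (right_ne_zero_of_mul hf), HeightOnePrime.order_zpow,
      HeightOnePrime.order_algebraMap _ h.ne_zero (ha i),
      HeightOnePrime.order_algebraMap_of_notMem _
        fun hmem => (P i).1.isPrime.ne_top (Ideal.eq_top_of_isUnit_mem _ hmem hw), add_zero]
  · rintro ⟨c, hc⟩
    refine ⟨algebraMap R (FractionRing R) t ^ c, zpow_ne_zero _ ht0, fun Q => ?_⟩
    rw [HeightOnePrime.order_zpow]
    by_cases hQ : t ∈ Q.1.asIdeal
    · obtain ⟨i, rfl⟩ := h.exists_eq_of_mem hrange hQ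
      rw [sum_single_apply hP, hc, HeightOnePrime.order_algebraMap _ h.ne_zero (ha i)]
    · rw [sum_single_apply_of_notMem hrange _ hQ,
        HeightOnePrime.order_algebraMap_of_notMem _ hQ, mul_zero]

end IsPrimeDenominator

/-! ### The toric ring inside the polynomial ring -/

section ToricRing

variable (K : Type*) [Field K] {n : ℕ} (Δ : AbstractSimplicialComplex (Fin n))

theorem algebraMap_toricT : algebraMap (toricRing K Δ) (PolyXT K n) (toricT K Δ) =
    MvPolynomial.X none := by
  change faceMonomial K ∅ = _
  rw [faceMonomial, Finset.prod_empty, one_mul]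

theorem exists_algebraMap_eq_X_mul (i : Fin n) : ∃ r : toricRing K Δ,
    algebraMap (toricRing K Δ) (PolyXT K n) r = MvPolynomial.X (some i) * MvPolynomial.X none :=
  ⟨⟨faceMonomial K {i},
    Algebra.subset_adjoin ⟨{i}, Set.mem_insert_of_mem _ (Δ.singleton_mem i), rfl⟩⟩,
    by change faceMonomial K {i} = _; rw [faceMonomial, Finset.prod_singleton]⟩

/-- Each factor `xᵢ` of a monomial costs one power of `t`, since `xᵢt` lies in `R`; units of the
polynomial ring are constants, already in `R`. Of `Δ`, only the faces `∅` and `{i}` matter. -/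
theorem isPrimeDenominator_toricT : IsPrimeDenominator (PolyXT K n) (toricT K Δ) where
  prime := by
    rw [algebraMap_toricT]
    exact MvPolynomial.X_prime
  exists_pow_mul s := by
    rw [algebraMap_toricT]
    induction s using MvPolynomial.induction_on with
    | C k => exact ⟨0, algebraMap K _ k, by rw [pow_zero, one_mul]; rfl⟩
    | add p q hp hq =>
      obtain ⟨N₁, r₁, h₁⟩ := hp
      obtain ⟨N₂, r₂, h₂⟩ := hq
      refine ⟨N₁ + N₂, toricT K Δ ^ N₂ * r₁ + toricT K Δ ^ N₁ * r₂, ?_⟩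
      rw [map_add, map_mul, map_mul, map_pow, map_pow, algebraMap_toricT, h₁, h₂]
      ring
    | mul_X p i hp =>
      obtain ⟨N, r, h⟩ := hp
      cases i with
      | none =>
        refine ⟨N, r * toricT K Δ, ?_⟩
        rw [map_mul, algebraMap_toricT, h, mul_assoc]
      | some i =>
        obtain ⟨x, hx⟩ := exists_algebraMap_eq_X_mul K Δ i
        refine ⟨N + 1, r * x, ?_⟩
        rw [map_mul, h, hx]
        ring
  exists_unit u hu := by
    obtain ⟨k, hk, rfl⟩ := MvPolynomial.isUnit_iff_eq_C_of_isReduced.1 hu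
    exact ⟨algebraMap K _ k, hk.map _, rfl⟩

end ToricRing

theorem theorem1 {K : Type*} [Field K] {n : ℕ} (Δ : AbstractSimplicialComplex (Fin n))
    (hnormal : IsIntegrallyClosed (toricRing K Δ)) :
    -- the minimal primes of `(t)` are finitely many, they have height one, the localization at
    -- each of them is a discrete valuation ring, and the exponents `a` exist and are unique
    (Ideal.span {toricT K Δ}).minimalPrimes.Finite ∧
    (∀ (P : Ideal (toricRing K Δ)) [P.IsPrime], P ∈ (Ideal.span {toricT K Δ}).minimalPrimes →
      P.height = 1 ∧ IsDiscreteValuationRing (Localization.AtPrime P) ∧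
      ∃! a : ℕ, Ideal.span {algebraMap (toricRing K Δ) (Localization.AtPrime P) (toricT K Δ)} =
        (P.map (algebraMap (toricRing K Δ) (Localization.AtPrime P))) ^ a) ∧
    -- for every enumeration `P₁, …, P_r` of the minimal primes of `(t)`:
    ∀ (r : ℕ) (P : Fin r → HeightOnePrime (toricRing K Δ)), Function.Injective P →
      Set.range (fun i => (P i).1.asIdeal) = (Ideal.span {toricT K Δ}).minimalPrimes →
      AddSubgroup.closure (Set.range fun i => (P i).divisorClass) = ⊤ ∧
      ∀ a : Fin r → ℕ,
        (∀ i, Ideal.span {algebraMap (toricRing K Δ) (P i).Loc (toricT K Δ)} =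
          ((P i).1.asIdeal.map (algebraMap (toricRing K Δ) (P i).Loc)) ^ a i) →
        ∀ b : Fin r → ℤ, ∑ i, b i • (P i).divisorClass = 0 ↔ ∃ c : ℤ, ∀ i, b i = c * a i := by
  have h := isPrimeDenominator_toricT K Δ
  refine ⟨Ideal.finite_minimalPrimes_of_isNoetherianRing _ _, fun P _ hP => ?_,
    fun r P hP hrange => ⟨h.closure_divisorClass_eq_top hP hrange,
      fun a ha b => h.sum_smul_divisorClass_eq_zero_iff hP hrange ha b⟩⟩
  have hheight := HeightOnePrime.height_eq_one_of_mem_minimalPrimes_span_singleton h.ne_zero hP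
  let p : HeightOnePrime (toricRing K Δ) := ⟨⟨P, inferInstance⟩, hheight⟩
  exact ⟨hheight, p.isDiscreteValuationRing_loc, p.existsUnique_span_eq_pow h.ne_zero⟩
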